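/- Let $\mathcal G=(V,E)$ be a connected, locally finite, non-oriented graph (finite or infinite) without loops or multiple edges, with graph distance $d_{\mathcal G}$, and for $U,U'\subset V$ let $d_{\mathcal G}(U,U')=\inf_{i\in U,\,j\in U'}d_{\mathcal G}(i,j)$. For positive conductances $W=(W_e)_{e\in E}$, $W_{i,j}=W_{\{i,j\}}$, let $\nu_V^W(d\beta)$ denote the law of the positive random field $(\beta_i)_{i\in V}$ such that for every finite $U\subset V$ and every $(\lambda_i)_{i\in U}\in\mathbb R_+^U$, $$\int e^{-\sum_{i\in U}\lambda_i\beta_i}\,\nu_V^W(d\beta)=\exp\Big(-\sum_{i\sim j,\ i,j\in U}W_{i,j}\big(\sqrt{(1+\lambda_i)(1+\lambda_j)}-1\big)-\sum_{i\sim j,\ i\in U,\ j\notin U}W_{i,j}\big(\sqrt{1+\lambda_i}-1\big)\Big)\prod_{i\in U}\frac1{\sqrt{1+\lambda_i}},$$ where each non-oriented edge is counted once. This law exists, is unique, and depends measurably on $W$ (that is, $W\mapsto\nu_V^W$ is a probability kernel). Let $(a_e)_{e\in E}$ be positive weights, let $(W_e)_{e\in E}$ be independent random variables, $W_e$ having law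 $\mathrm{Gamma}(a_e,1)$ (shape $a_e$, rate $1$), and define the probability measure $\tilde\nu_V^a(d\beta)=\mathbb E\big[\nu_V^W(d\beta)\big]$, the expectation being with respect to $W$. Then under $\tilde\nu_V^a(d\beta)$ the field $(\beta_j)_{j\in V}$ is 1-dependent: if $U,U'\subset V$ (finite or infinite) satisfy $d_{\mathcal G}(U,U')\ge 2$, then $(\beta_i)_{i\in U}$ and $(\beta_j)_{j\in U'}$ are independent. -/

import Mathlib

open MeasureTheory ProbabilityTheory

namespace BetaField

noncomputable section

variable {V : Type*}

open Classical in
/-- The conductance `W_{i,j}` of the pair `i, j`, symmetric in `i` and `j`: it is the weight of the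
edge `{i, j}`, and `0` when `i` and `j` are not neighbours. -/
def cond (G : SimpleGraph V) (W : G.edgeSet → ℝ) (i j : V) : ℝ :=
  if h : G.Adj i j then W ⟨s(i, j), h⟩ else 0

open Classical in
/-- The exponent of the Laplace transform of `(β_i)_{i ∈ U}`. The first sum runs over the
non-oriented edges inside `U`, each counted once (the double sum meets each of them twice, once in
each orientation, whence the factor `1 / 2`; there are no loops); the second one over the edges
`{i, j}` with `i ∈ U` and `j ∉ U`. -/
def laplaceExponent (G : SimpleGraph V) [G.LocallyFinite] (W : G.edgeSet → ℝ)
    (U : Finset V) (lam : V → ℝ) : ℝ :=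
  (1 / 2 : ℝ) * ∑ i ∈ U, ∑ j ∈ U,
      cond G W i j * (Real.sqrt ((1 + lam i) * (1 + lam j)) - 1)
    + ∑ i ∈ U, ∑ j ∈ G.neighborFinset i with j ∉ U,
      cond G W i j * (Real.sqrt (1 + lam i) - 1)

/-- `ν` is the law `ν_V^W` of the random potential `β` on the graph `G` with conductances `W`: a
probability measure on `ℝ^V` (with the product `σ`-algebra), carried by positive fields, whose
finite-dimensional marginals have the prescribed Laplace transforms. -/
structure IsBetaLaw (G : SimpleGraph V) [G.LocallyFinite] (W : G.edgeSet → ℝ)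
    (ν : Measure (V → ℝ)) : Prop where
  isProbabilityMeasure : IsProbabilityMeasure ν
  pos : ∀ i : V, ∀ᵐ β ∂ν, 0 < β i
  laplace : ∀ (U : Finset V) (lam : V → ℝ), (∀ i ∈ U, 0 ≤ lam i) →
    ∫ β, Real.exp (-∑ i ∈ U, lam i * β i) ∂ν =
      Real.exp (-laplaceExponent G W U lam) * (1 / ∏ i ∈ U, Real.sqrt (1 + lam i))

/-- The law of independent conductances `(W_e)`, where `W_e` has law `Gamma(a_e, 1)` (shape `a_e`,
rate `1`). -/
def gammaConductances (G : SimpleGraph V) (a : G.edgeSet → ℝ) : Measure (G.edgeSet → ℝ) :=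
  Measure.infinitePi fun e => gammaMeasure (a e) 1

/-- The averaged law `ν̃^a(dβ) = E[ν^W(dβ)]`, the conductances `W` being distributed according to
`gammaConductances G a`, for a family `ν` of laws that depends measurably on `W`. -/
def mixedLaw (G : SimpleGraph V) (a : G.edgeSet → ℝ) (ν : Kernel (G.edgeSet → ℝ) (V → ℝ)) :
    Measure (V → ℝ) :=
  (gammaConductances G a).bind ν

/-- The graph distance `inf_{i ∈ U, j ∈ U'} d(i, j)` between two sets of vertices
(`⊤` if one of them is empty). -/
def setDist (G : SimpleGraph V) (U U' : Set V) : ℕ∞ :=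
  ⨅ i ∈ U, ⨅ j ∈ U', G.edist i j

/-- Under `ν` the coordinate field is 1-dependent: the restrictions of `β` to two (finite or
infinite) sets of vertices at distance at least `2` are independent. -/
def OneDependent (G : SimpleGraph V) (ν : Measure (V → ℝ)) : Prop :=
  ∀ U U' : Set V, 2 ≤ setDist G U U' →
    IndepFun (fun (β : V → ℝ) (i : U) => β i) (fun (β : V → ℝ) (j : U') => β j) ν

end

end BetaField

/-! Put `x_i = √(1 + λ_i) - 1`. Since `√((1 + λ_i)(1 + λ_j)) - 1 = x_i x_j + x_i + x_j`, the Laplace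
exponent is `∑ W_{ij} x_i x_j` over the edges inside `U`, plus `∑ D_i x_i`, where `D_i` is the sum
of all conductances at `i` (`laplaceExponent_eq_quadExponent`). It therefore involves only edges
touching `U`. For two sets at distance at least 2 there is no cross term, so the transform
factorizes for each fixed `W` (`graphTransform_add`), and the two factors read disjoint sets of
edges (`disjoint_edgesAt`). Independence of the conductances then makes the averaged transform
factorize too, which gives independence of the two restrictions.

The kernel must also be constructed. In the variables `y_i = exp (-β_i)` the field lives in the
compact cube `[0,1]^V`, where Laplace transforms become moments. By Stone-Weierstrass moments
determine a measure (`ext_of_integral_mom`) and its measurable dependence on a parameter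
(`measurable_of_integral_mom`). Finite fields are built one site at a time: given `β_n`, the
remaining sites again form a field of the same type, with a rank-one change of the interactions
(`exists_measure_integral_mom_eq_betaTransform`). Compactness then yields the infinite field. -/

namespace BetaField

/-! ### Gaussian integrals with an inverse-square term. -/

open Real Set in
/-- The Cauchy-Schlömilch substitution for the Gaussian integral. -/
theorem integral_exp_neg_sq_sub_div {r c : ℝ} (hr : 0 < r) (hc : 0 ≤ c) :
    ∫ u in Ioi (0 : ℝ), exp (-(r * u - c / u) ^ 2) = √π / (2 * r) := by
  -- The substitution below needs `c > 0`: for `c = 0` the inverse map would vanish on the negative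
  -- half-line.
  rcases hc.eq_or_lt with rfl | hc
  · have := integral_gaussian_Ioi (r ^ 2)
    simp only [zero_div, sub_zero, mul_pow, ← neg_mul]
    rw [this, sqrt_div pi_pos.le, sqrt_sq hr.le]
    field_simp
  set S : ℝ → ℝ := fun v => √(v ^ 2 + 4 * r * c) with hS
  have hpos : ∀ v : ℝ, 0 < v ^ 2 + 4 * r * c := fun v => by positivity
  have hSpos : ∀ v, 0 < S v := fun v => sqrt_pos.2 (hpos v)
  have hSsq : ∀ v, S v ^ 2 = v ^ 2 + 4 * r * c := fun v => sq_sqrt (hpos v).le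
  have hSv : ∀ v, |v| < S v := fun v => by
    refine abs_lt_of_sq_lt_sq ?_ (hSpos v).le
    rw [hSsq]; have := mul_pos hr hc; linarith
  -- The positive root of `r u² - v u - c = 0`, that is, the inverse of `u ↦ r u - c / u` from `(0,
  -- ∞)` onto `ℝ`.
  set g : ℝ → ℝ := fun v => (v + S v) / (2 * r) with hg
  have hgpos : ∀ v, 0 < g v := fun v => by
    have := (abs_lt.1 (hSv v)).1
    exact div_pos (by linarith) (by positivity)
  have hginv : ∀ v, r * g v - c / g v = v := fun v => by
    have h0 := (hgpos v).ne'
    have : r * g v ^ 2 - v * g v - c = 0 := by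
      simp only [hg]; field_simp; nlinarith [hSsq v]
    field_simp; linarith
  have hgsurj : ∀ u, 0 < u → g (r * u - c / u) = u := fun u hu => by
    have : S (r * u - c / u) = r * u + c / u := by
      rw [hS]; dsimp only
      rw [show (r * u - c / u) ^ 2 + 4 * r * c = (r * u + c / u) ^ 2 by field_simp; ring]
      exact sqrt_sq (by positivity)
    simp only [hg, this]; field_simp; ring
  have himg : g '' univ = Ioi 0 := by
    ext u
    simp only [image_univ, mem_range, mem_Ioi]
    exact ⟨by rintro ⟨v, rfl⟩; exact hgpos v, fun hu => ⟨_, hgsurj u hu⟩⟩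
  have hginj : InjOn g univ := fun v _ w _ h => by rw [← hginv v, ← hginv w, h]
  have hder : ∀ v ∈ univ, HasDerivWithinAt g ((1 + v / S v) / (2 * r)) univ v := fun v _ => by
    have h1 : HasDerivAt (fun v : ℝ => v ^ 2 + 4 * r * c) (2 * v) v := by
      simpa using (hasDerivAt_pow 2 v).add_const (4 * r * c)
    have h2 := h1.sqrt (hpos v).ne'
    have h3 := ((hasDerivAt_id v).add h2).div_const (2 * r)
    refine (h3.congr_deriv ?_).hasDerivWithinAt
    simp only [hS]; field_simp
  have hfac : ∀ v, 0 ≤ (1 + v / S v) / (2 * r) := fun v => by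
    have h1 := (abs_lt.1 (hSv v)).1
    have : -1 ≤ v / S v := by rw [le_div_iff₀ (hSpos v)]; linarith
    exact div_nonneg (by linarith) (by positivity)
  rw [← himg, integral_image_eq_integral_abs_deriv_smul MeasurableSet.univ hder hginj]
  simp only [hginv, smul_eq_mul, setIntegral_univ, fun v => abs_of_nonneg (hfac v)]
  have hint : Integrable fun v : ℝ => exp (-v ^ 2) := by
    simpa using integrable_exp_neg_mul_sq one_pos
  have hcont : Continuous S := by fun_prop
  have hint2 : Integrable fun v : ℝ => v / S v * exp (-v ^ 2) := by
    refine hint.bdd_mul (c := 1) (by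
      exact (continuous_id.div hcont fun v => (hSpos v).ne').aestronglyMeasurable) ?_
    refine .of_forall fun v => ?_
    rw [norm_eq_abs, abs_div, abs_of_pos (hSpos v), div_le_one (hSpos v)]
    exact (hSv v).le
  -- The non-constant part of the Jacobian is odd, so only the factor `1 / (2r)` survives against
  -- the even Gaussian.
  have hodd : ∫ v : ℝ, v / S v * exp (-v ^ 2) = 0 := by
    have h := integral_neg_eq_self (fun v : ℝ => v / S v * exp (-v ^ 2)) volume
    have h' : ∀ v : ℝ, -v / S (-v) * exp (-(-v) ^ 2) = -(v / S v * exp (-v ^ 2)) := fun v => by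
      simp only [hS, neg_sq]; ring
    simp only [h', integral_neg] at h
    linarith
  have hgauss : ∫ v : ℝ, exp (-v ^ 2) = √π := by simpa using integral_gaussian 1
  calc ∫ v : ℝ, (1 + v / S v) / (2 * r) * exp (-v ^ 2)
      = ∫ v : ℝ, (1 / (2 * r)) * (exp (-v ^ 2) + v / S v * exp (-v ^ 2)) := by
        congr 1; ext v; ring
    _ = √π / (2 * r) := by
        rw [integral_const_mul, integral_add hint hint2, hodd, hgauss]; ring

open Real Set in
-- Completing the square, `a u² + c² / (4u²) = (√a u - c / (2u))² + √a c`.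
theorem integral_exp_neg_mul_sq_sub_div_sq {a c : ℝ} (ha : 0 < a) (hc : 0 ≤ c) :
    ∫ u in Ioi (0 : ℝ), exp (-(a * u ^ 2) - c ^ 2 / (4 * u ^ 2)) =
      √π / 2 * (exp (-(√a * c)) / √a) := by
  have hr := sqrt_pos.2 ha
  have h := integral_exp_neg_sq_sub_div hr (div_nonneg hc zero_le_two)
  have : ∀ u ∈ Ioi (0 : ℝ), exp (-(a * u ^ 2) - c ^ 2 / (4 * u ^ 2)) =
      exp (-(√a * c)) * exp (-(√a * u - c / 2 / u) ^ 2) := fun u hu => by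
    have hu : u ≠ 0 := (mem_Ioi.1 hu).ne'
    rw [← exp_add]
    congr 1
    have h1 : (√a * u - c / 2 / u) ^ 2 = √a ^ 2 * u ^ 2 - √a * c + c ^ 2 / (4 * u ^ 2) := by
      field_simp; ring
    rw [h1, sq_sqrt ha.le]; ring
  rw [setIntegral_congr_fun measurableSet_Ioi this, integral_const_mul, h]
  field_simp

/-! ### Measures on the cube and their moments. -/

section

open scoped NNReal unitInterval
open Filter Topology

/-- The monomial `∏ y_i ^ λ_i` on the cube `[0, 1]^V`. -/
noncomputable def mom {V : Type*} (lam : V →₀ ℝ≥0) (y : V → I) : ℝ :=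
  lam.prod fun i a => (y i : ℝ) ^ (a : ℝ)

theorem mom_zero {V : Type*} (y : V → I) : mom 0 y = 1 := Finsupp.prod_zero_index

theorem mom_add {V : Type*} (lam lam' : V →₀ ℝ≥0) (y : V → I) :
    mom (lam + lam') y = mom lam y * mom lam' y := by
  classical
  refine Finsupp.prod_add_index' (fun i => by simp) fun i a b => ?_
  exact Real.rpow_add_of_nonneg (y i).2.1 a.coe_nonneg b.coe_nonneg

theorem mom_single {V : Type*} (i : V) (a : ℝ≥0) (y : V → I) :
    mom (Finsupp.single i a) y = (y i : ℝ) ^ (a : ℝ) :=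
  Finsupp.prod_single_index (by simp)

theorem mom_nonneg {V : Type*} (lam : V →₀ ℝ≥0) (y : V → I) : 0 ≤ mom lam y :=
  Finset.prod_nonneg fun i _ => Real.rpow_nonneg (y i).2.1 _

theorem mom_le_one {V : Type*} (lam : V →₀ ℝ≥0) (y : V → I) : mom lam y ≤ 1 :=
  Finset.prod_le_one (fun i _ => Real.rpow_nonneg (y i).2.1 _)
    fun i _ => Real.rpow_le_one (y i).2.1 (y i).2.2 (lam i).2

theorem continuous_mom {V : Type*} (lam : V →₀ ℝ≥0) : Continuous (mom lam) :=
  continuous_finsetProd _ fun i _ =>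
    (continuous_subtype_val.comp (continuous_apply i)).rpow_const fun _ => Or.inr (lam i).2

theorem mom_eq_prod_of_subset {V : Type*} {lam : V →₀ ℝ≥0} {T : Finset V} (h : lam.support ⊆ T)
    (y : V → I) : mom lam y = ∏ i ∈ T, (y i : ℝ) ^ (lam i : ℝ) :=
  Finsupp.prod_of_support_subset _ h _ (by simp)

theorem measurable_mom {V : Type*} (lam : V →₀ ℝ≥0) : Measurable (mom (V := V) lam) :=
  Finset.measurable_prod _ fun i _ =>
    (measurable_subtype_coe.comp (measurable_pi_apply i)).pow_const _

theorem integrable_mom {V : Type*} (lam : V →₀ ℝ≥0) (μ : Measure (V → I)) [IsFiniteMeasure μ] :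
    Integrable (mom lam) μ :=
  .of_bound (measurable_mom lam).aestronglyMeasurable 1 (.of_forall fun y => by
    rw [Real.norm_of_nonneg (mom_nonneg lam y)]; exact mom_le_one lam y)

/-- The monomials as a multiplicative submonoid of the continuous functions on the cube. -/
noncomputable def momHom (V : Type*) : Multiplicative (V →₀ ℝ≥0) →* C(V → I, ℝ) where
  toFun lam := ⟨mom lam.toAdd, continuous_mom _⟩
  map_one' := by ext y; exact mom_zero y
  map_mul' a b := by ext y; exact mom_add _ _ y

/-- Stone-Weierstrass for monomials: a linear closed property of continuous functions on the cube
that holds for monomials holds for all of them. -/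
theorem continuousMap_cube_induction {V : Type*} {Q : C(V → I, ℝ) → Prop}
    (hmom : ∀ lam, Q (momHom V lam)) (hzero : Q 0) (hadd : ∀ f g, Q f → Q g → Q (f + g))
    (hsmul : ∀ (c : ℝ) f, Q f → Q (c • f))
    (hlim : ∀ (f : ℕ → C(V → I, ℝ)) g, (∀ n, Q (f n)) → Tendsto f atTop (𝓝 g) → Q g) (f) : Q f := by
  let A : Subalgebra ℝ C(V → I, ℝ) := Algebra.adjoin ℝ (MonoidHom.mrange (momHom V))
  have hA : ∀ g ∈ A, Q g := fun g hg => by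
    -- Monomials are closed under multiplication, so the algebra they generate is just their linear
    -- span.
    rw [← Subalgebra.mem_toSubmodule, Algebra.adjoin_eq_span, Submonoid.closure_eq] at hg
    induction hg using Submodule.span_induction with
    | mem x h => obtain ⟨l, rfl⟩ := h; exact hmom l
    | zero => exact hzero
    | add x y _ _ hx hy => exact hadd _ _ hx hy
    | smul a x _ hx => exact hsmul _ _ hx
  have hsep : A.SeparatesPoints := fun y z hyz => by
    obtain ⟨i, hi⟩ := Function.ne_iff.1 hyz
    refine ⟨_, ⟨momHom V (.ofAdd (Finsupp.single i 1)), Algebra.subset_adjoin ⟨_, rfl⟩, rfl⟩, ?_⟩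
    change mom (Finsupp.single i 1) y ≠ mom (Finsupp.single i 1) z
    simp only [mom_single, NNReal.coe_one, Real.rpow_one]
    exact fun h => hi (Subtype.ext h)
  have hf := ContinuousMap.continuousMap_mem_subalgebra_closure_of_separatesPoints A hsep f
  rw [← SetLike.mem_coe, Subalgebra.topologicalClosure_coe, mem_closure_iff_seq_limit] at hf
  obtain ⟨u, hu, hlim'⟩ := hf
  exact hlim u f (fun n => hA _ (hu n)) hlim'

section Countable

variable {V : Type*} [Countable V]

theorem integrable_continuousMap (μ : Measure (V → I)) [IsFiniteMeasure μ] (f : C(V → I, ℝ)) :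
    Integrable f μ :=
  .of_bound f.continuous.measurable.aestronglyMeasurable ‖f‖ (.of_forall f.norm_coe_le_norm)

theorem tendsto_integral_continuousMap (μ : Measure (V → I)) [IsFiniteMeasure μ]
    {f : ℕ → C(V → I, ℝ)} {g : C(V → I, ℝ)} (h : Tendsto f atTop (𝓝 g)) :
    Tendsto (fun n => ∫ y, f n y ∂μ) atTop (𝓝 (∫ y, g y ∂μ)) := by
  rw [tendsto_iff_norm_sub_tendsto_zero]
  have h' := (tendsto_iff_norm_sub_tendsto_zero.1 h).mul_const (μ.real Set.univ)
  rw [zero_mul] at h'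
  refine squeeze_zero (fun _ => norm_nonneg _) (fun n => ?_) h'
  rw [← integral_sub (integrable_continuousMap μ _) (integrable_continuousMap μ _)]
  exact norm_integral_le_of_norm_le_const (.of_forall (f n - g).norm_coe_le_norm)

/-- Finite measures on the cube are determined by their moments. -/
theorem ext_of_integral_mom {μ ν : Measure (V → I)} [IsFiniteMeasure μ] [IsFiniteMeasure ν]
    (h : ∀ lam, ∫ y, mom lam y ∂μ = ∫ y, mom lam y ∂ν) : μ = ν := by
  have key : ∀ f : C(V → I, ℝ), ∫ y, f y ∂μ = ∫ y, f y ∂ν := by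
    refine continuousMap_cube_induction (fun lam => h lam.toAdd) (by simp) (fun f g hf hg => ?_)
      (fun c f hf => ?_) fun f g hf hg => ?_
    · simp only [ContinuousMap.add_apply]
      rw [integral_add (integrable_continuousMap _ _) (integrable_continuousMap _ _),
        integral_add (integrable_continuousMap _ _) (integrable_continuousMap _ _), hf, hg]
    · simp only [ContinuousMap.smul_apply, integral_smul, hf]
    · refine tendsto_nhds_unique (tendsto_integral_continuousMap μ hg) ?_
      simpa only [hf] using tendsto_integral_continuousMap ν hg
  let := TopologicalSpace.pseudoMetrizableSpacePseudoMetric (V → I)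
  exact ext_of_forall_integral_eq_of_IsFiniteMeasure fun f => key f.toContinuousMap

/-- A family of probability measures on the cube is measurable as soon as its moments are. -/
theorem measurable_of_integral_mom {Θ : Type*} [MeasurableSpace Θ] {μ : Θ → Measure (V → I)}
    [∀ θ, IsProbabilityMeasure (μ θ)] (h : ∀ lam, Measurable fun θ => ∫ y, mom lam y ∂μ θ) :
    Measurable μ := by
  have key : ∀ f : C(V → I, ℝ), Measurable fun θ => ∫ y, f y ∂μ θ := by
    refine continuousMap_cube_induction (fun lam => h lam.toAdd) (by simp) (fun f g hf hg => ?_)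
      (fun c f hf => ?_) fun f g hf hg => ?_
    · simp only [ContinuousMap.add_apply]
      simp_rw [fun θ => integral_add (integrable_continuousMap (μ θ) f)
        (integrable_continuousMap (μ θ) g)]
      exact hf.add hg
    · simp only [ContinuousMap.smul_apply, integral_smul]
      exact hf.const_smul c
    · exact measurable_of_tendsto_metrizable hf
        (tendsto_pi_nhds.2 fun θ => tendsto_integral_continuousMap (μ θ) hg)
  let := TopologicalSpace.pseudoMetrizableSpacePseudoMetric (V → I)
  -- Closed sets form a generating π-system, and their indicators are limits of continuous
  -- functions.
  refine .measure_of_isPiSystem_of_isProbabilityMeasure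
    ((BorelSpace.measurable_eq (α := V → I)).trans borel_eq_generateFrom_isClosed)
    isPiSystem_isClosed fun F hF => ?_
  refine measurable_of_tendsto_metrizable (f := fun n θ => ∫⁻ y, (hF.apprSeq n y : ENNReal) ∂μ θ)
    (fun n => ?_) (tendsto_pi_nhds.2 fun θ =>
      HasOuterApproxClosed.tendsto_lintegral_apprSeq hF (μ θ))
  have := (key ⟨fun y => (hF.apprSeq n y : ℝ),
    NNReal.continuous_coe.comp (hF.apprSeq n).continuous⟩).ennreal_ofReal
  convert! this using 2 with θ
  change _ = ENNReal.ofReal (∫ y, (hF.apprSeq n y : ℝ) ∂μ θ)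
  rw [← BoundedContinuousFunction.toReal_lintegral_coe_eq_integral, ENNReal.ofReal_toReal]
  exact (BoundedContinuousFunction.lintegral_lt_top_of_nnreal _ _).ne

end Countable

end

/-! ### Finite random potentials, one site at a time. -/

section

open scoped NNReal unitInterval
open Finset

section Transform

variable {V : Type*}

/-- The exponent of the Laplace transform of a finite random potential, as a quadratic function of
`x_i = √(1 + λ_i) - 1`. -/
noncomputable def quadExponent (U : Finset V) (P : V → V → ℝ) (D x : V → ℝ) : ℝ :=
  1 / 2 * ∑ i ∈ U, ∑ j ∈ U, P i j * x i * x j + ∑ i ∈ U, D i * x i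

/-- The change of variables `x_i = √(1 + λ_i) - 1`. -/
noncomputable def sqrtShift (lam : V →₀ ℝ≥0) (i : V) : ℝ := √(1 + (lam i : ℝ)) - 1

/-- The Laplace transform of a finite random potential, with interactions `P` and total weights
`D`. -/
noncomputable def betaTransform (U : Finset V) (P : V → V → ℝ) (D : V → ℝ) (lam : V →₀ ℝ≥0) : ℝ :=
  Real.exp (-quadExponent U P D (sqrtShift lam)) * ∏ i ∈ U, (√(1 + (lam i : ℝ)))⁻¹

theorem sqrtShift_nonneg (lam : V →₀ ℝ≥0) (i : V) : 0 ≤ sqrtShift lam i :=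
  sub_nonneg.2 (Real.one_le_sqrt.2 (by simp))

theorem sqrtShift_eq_zero {lam : V →₀ ℝ≥0} {i : V} (h : lam i = 0) : sqrtShift lam i = 0 := by
  simp [sqrtShift, h]

theorem quadExponent_congr {U : Finset V} {P P' : V → V → ℝ} {D D' x x' : V → ℝ}
    (hP : ∀ i ∈ U, ∀ j ∈ U, P i j = P' i j) (hD : ∀ i ∈ U, D i = D' i) (hx : ∀ i ∈ U, x i = x' i) :
    quadExponent U P D x = quadExponent U P' D' x' := by
  unfold quadExponent
  congr 1
  · congr 1
    exact sum_congr rfl fun i hi => sum_congr rfl fun j hj => by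
      rw [hP i hi j hj, hx i hi, hx j hj]
  · exact sum_congr rfl fun i hi => by rw [hD i hi, hx i hi]

theorem betaTransform_erase [DecidableEq V] {U : Finset V} {n : V} (hn : n ∉ U) (P : V → V → ℝ)
    (D : V → ℝ) (lam : V →₀ ℝ≥0) :
    betaTransform U P D (lam.erase n) = betaTransform U P D lam := by
  have h : ∀ i ∈ U, lam.erase n i = lam i := fun i hi =>
    Finsupp.erase_ne (ne_of_mem_of_not_mem hi hn)
  have hx : ∀ i ∈ U, sqrtShift (lam.erase n) i = sqrtShift lam i := fun i hi => by
    simp only [sqrtShift, h i hi]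
  unfold betaTransform
  rw [prod_congr rfl fun i hi => by rw [h i hi],
    quadExponent_congr (fun _ _ _ _ => rfl) (fun _ _ => rfl) hx]

theorem quadExponent_insert [DecidableEq V] {U : Finset V} {n : V} (hn : n ∉ U) {P : V → V → ℝ}
    (hP : ∀ i j, P i j = P j i) (D x : V → ℝ) :
    quadExponent (insert n U) P D x = quadExponent U P D x + x n * ∑ i ∈ U, P n i * x i
      + 1 / 2 * P n n * x n ^ 2 + D n * x n := by
  have h : ∑ i ∈ U, P i n * x i * x n = x n * ∑ i ∈ U, P n i * x i := by
    rw [mul_sum]; exact sum_congr rfl fun i _ => by rw [hP i n]; ring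
  have h' : ∑ i ∈ U, P n i * x n * x i = x n * ∑ i ∈ U, P n i * x i := by
    rw [mul_sum]; exact sum_congr rfl fun i _ => by ring
  simp only [quadExponent, sum_insert hn, sum_add_distrib, h, h']
  ring

/-- The change felt by the other sites once site `n` is fixed. It enters only through `l = ∑ p_i
x_i`; for `t = 1 / (2u²)` the terms in `t` add up to `(l² + 2κl) / (4u²)`, the form integrated in
`integral_sqrtSiteLaw_exp`. -/
theorem quadExponent_rankOne (U : Finset V) (P : V → V → ℝ) (D x p : V → ℝ) (t κ : ℝ) :
    quadExponent U (fun i j => P i j + p i * p j * t) (fun i => D i - p i + κ * p i * t) x =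
      quadExponent U P D x - (∑ i ∈ U, p i * x i) + t / 2 * (∑ i ∈ U, p i * x i) ^ 2
        + κ * t * ∑ i ∈ U, p i * x i := by
  have h : t / 2 * (∑ i ∈ U, p i * x i) ^ 2 =
      1 / 2 * ∑ i ∈ U, ∑ j ∈ U, p i * p j * t * x i * x j := by
    rw [sq, sum_mul_sum, mul_sum, mul_sum]
    refine sum_congr rfl fun i _ => ?_
    rw [mul_sum, mul_sum]
    exact sum_congr rfl fun j _ => by ring
  rw [h]
  simp only [quadExponent, add_mul, sub_mul, sum_add_distrib, sum_sub_distrib, mul_sum]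
  simp only [mul_add, mul_sum]
  have : ∑ i ∈ U, κ * p i * t * x i = ∑ i ∈ U, κ * t * (p i * x i) :=
    sum_congr rfl fun i _ => by ring
  rw [this]
  ring

end Transform

open Real Set in
/-- The law of the square root of a one-site random potential with boundary weight `κ`. -/
noncomputable def sqrtSiteLaw (κ : ℝ) : Measure ℝ :=
  (volume.restrict (Ioi 0)).withDensity fun u =>
    ENNReal.ofReal (2 / √π * exp (κ - u ^ 2 - κ ^ 2 / (4 * u ^ 2)))

open Real Set in
theorem integral_sqrtSiteLaw (κ : ℝ) (f : ℝ → ℝ) :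
    ∫ u, f u ∂sqrtSiteLaw κ =
      ∫ u in Ioi 0, 2 / √π * exp (κ - u ^ 2 - κ ^ 2 / (4 * u ^ 2)) * f u := by
  rw [sqrtSiteLaw, integral_withDensity_eq_integral_toReal_smul (by fun_prop) (by simp)]
  refine integral_congr_ae (.of_forall fun u => ?_)
  simp only [smul_eq_mul]
  rw [ENNReal.toReal_ofReal (by positivity)]

open Real Set in
theorem isProbabilityMeasure_sqrtSiteLaw {κ : ℝ} (hκ : 0 ≤ κ) :
    IsProbabilityMeasure (sqrtSiteLaw κ) := by
  have h := integral_exp_neg_mul_sq_sub_div_sq one_pos hκ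
  have hfun : ∀ u : ℝ, 2 / √π * exp (κ - u ^ 2 - κ ^ 2 / (4 * u ^ 2)) =
      2 / √π * exp κ * exp (-(1 * u ^ 2) - κ ^ 2 / (4 * u ^ 2)) := fun u => by
    rw [mul_assoc, ← exp_add]; congr 2; ring
  have h1 : ∫ u in Ioi 0, 2 / √π * exp (κ - u ^ 2 - κ ^ 2 / (4 * u ^ 2)) = 1 := by
    simp only [hfun]
    rw [integral_const_mul, h, sqrt_one, exp_neg]
    field_simp
  constructor
  rw [sqrtSiteLaw, withDensity_apply _ MeasurableSet.univ, setLIntegral_univ,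
    ← ofReal_integral_eq_lintegral_ofReal (by
      -- A non-integrable function has integral 0 by convention, which contradicts the value 1.
      by_contra hc
      rw [integral_undef hc] at h1
      exact zero_ne_one h1) (.of_forall fun u => by positivity), h1, ENNReal.ofReal_one]

open Real Set in
/-- The moments of a random potential at one site, once the other sites are integrated out. -/
theorem integral_sqrtSiteLaw_exp {κ l : ℝ} (hκ : 0 ≤ κ) (hl : 0 ≤ l) {s : ℝ} (hs : 0 ≤ s) :
    ∫ u, exp (-(s * u ^ 2)) * exp (-((l ^ 2 + 2 * κ * l) / (4 * u ^ 2))) ∂sqrtSiteLaw κ =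
      exp (κ - √(1 + s) * (κ + l)) * (√(1 + s))⁻¹ := by
  have h := integral_exp_neg_mul_sq_sub_div_sq (a := 1 + s) (by linarith) (add_nonneg hκ hl)
  -- The factor in `l` completes `κ²` to `(κ + l)²`.
  have hfun : ∀ u : ℝ, 2 / √π * exp (κ - u ^ 2 - κ ^ 2 / (4 * u ^ 2)) *
      (exp (-(s * u ^ 2)) * exp (-((l ^ 2 + 2 * κ * l) / (4 * u ^ 2)))) =
      2 / √π * exp κ * exp (-((1 + s) * u ^ 2) - (κ + l) ^ 2 / (4 * u ^ 2)) := fun u => by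
    rw [mul_assoc (2 / √π), mul_assoc (2 / √π), ← exp_add, ← exp_add, ← exp_add]; congr 2; ring
  rw [integral_sqrtSiteLaw]
  simp only [hfun]
  rw [integral_const_mul, h, sub_eq_add_neg, exp_add]
  field_simp

section Finite

variable {V : Type*}

theorem measurable_betaTransform {Θ : Type*} [MeasurableSpace Θ] (U : Finset V)
    {P : Θ → V → V → ℝ} {D : Θ → V → ℝ} (hP : ∀ i j, Measurable fun θ => P θ i j)
    (hD : ∀ i, Measurable fun θ => D θ i) (lam : V →₀ ℝ≥0) :
    Measurable fun θ => betaTransform U (P θ) (D θ) lam := by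
  unfold betaTransform quadExponent
  refine Measurable.mul_const (Measurable.exp (Measurable.neg ?_)) _
  refine Measurable.add (Measurable.const_mul ?_ _) ?_
  · exact measurable_sum _ fun i _ => measurable_sum _ fun j _ =>
      ((hP i j).mul_const _).mul_const _
  · exact measurable_sum _ fun i _ => (hD i).mul_const _

theorem mom_update [DecidableEq V] (lam : V →₀ ℝ≥0) (n : V) (y : V → I) (z : I) :
    mom lam (Function.update y n z) = (z : ℝ) ^ (lam n : ℝ) * mom (lam.erase n) y := by
  conv_lhs => rw [← Finsupp.single_add_erase n lam]
  rw [mom_add, mom_single, Function.update_self]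
  congr 1
  refine Finset.prod_congr rfl fun i hi => ?_
  rw [Finsupp.support_erase] at hi
  simp only [Function.update_of_ne (Finset.ne_of_mem_erase hi)]

/-- Existence of finite random potentials: the law exists for symmetric nonnegative interactions
`P` dominated by the total weights `D`. -/
theorem exists_measure_integral_mom_eq_betaTransform [Countable V] (U : Finset V) :
    ∀ (P : V → V → ℝ) (D : V → ℝ), (∀ i j, 0 ≤ P i j) → (∀ i j, P i j = P j i) →
      (∀ i ∈ U, ∑ j ∈ U, P i j ≤ D i) →
      ∃ μ : Measure (V → I), IsProbabilityMeasure μ ∧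
        ∀ lam, ∫ y, mom lam y ∂μ = betaTransform U P D lam := by
  classical
  induction U using Finset.induction_on with
  | empty =>
    intro P D _ _ _
    -- Coordinates outside the finite set are frozen at `y = 1`, so the moment formula holds for
    -- every `lam`, whatever its support.
    refine ⟨Measure.dirac 1, inferInstance, fun lam => ?_⟩
    rw [integral_dirac' _ _ (continuous_mom lam).measurable.stronglyMeasurable]
    simp [mom, betaTransform, quadExponent, Finsupp.prod]
  | insert n U hn ih =>
    intro P D hP hsymm hD
    -- Conditioning creates diagonal interactions. Since `λ = x² + 2x`, the term `P n n * x² / 2`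
    -- amounts to shifting `β_n` by `P n n / 2`, which leaves the weight `κ` in place of `D n`.
    set κ := D n - P n n with hκdef
    have hκU : ∑ j ∈ U, P n j ≤ κ := by
      have := hD n (mem_insert_self n U)
      rw [sum_insert hn] at this
      linarith
    have hκ : 0 ≤ κ := (sum_nonneg fun j _ => hP n j).trans hκU
    set P' : ℝ → V → V → ℝ := fun u i j => P i j + P n i * P n j * (1 / (2 * u ^ 2)) with hP'
    set D' : ℝ → V → ℝ := fun u i => D i - P n i + κ * P n i * (1 / (2 * u ^ 2)) with hD'
    have hex : ∀ u : ℝ, ∃ μ : Measure (V → I), IsProbabilityMeasure μ ∧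
        ∀ lam, ∫ y, mom lam y ∂μ = betaTransform U (P' u) (D' u) lam := fun u => by
      -- This includes `u = 0`, where the quotient is 0. Domination survives because `∑ p_j ≤ κ`
      -- with `p_j = P n j`, while `D i - p_i` still dominates the old row sum over `U`.
      have ht : 0 ≤ 1 / (2 * u ^ 2) := by positivity
      refine ih _ _ (fun i j => ?_) (fun i j => ?_) fun i hi => ?_
      · exact add_nonneg (hP i j) (mul_nonneg (mul_nonneg (hP n i) (hP n j)) ht)
      · simp only [hP', hsymm i j]; ring
      · have h1 := hD i (mem_insert_of_mem hi)
        rw [sum_insert hn, hsymm i n] at h1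
        have h2 : ∑ j ∈ U, P n i * P n j * (1 / (2 * u ^ 2)) =
            (∑ j ∈ U, P n j) * (P n i * (1 / (2 * u ^ 2))) := by
          rw [sum_mul]; exact sum_congr rfl fun j _ => by ring
        have h3 := mul_le_mul_of_nonneg_right hκU (mul_nonneg (hP n i) ht)
        simp only [hP', hD', sum_add_distrib, h2]
        linarith
    choose μ hμ hmom using hex
    -- The measures were chosen separately for each `u`; their explicit moments give measurability.
    let K : Kernel ℝ (V → I) := ⟨μ, measurable_of_integral_mom fun lam => by
      simp only [hmom]
      exact measurable_betaTransform U (fun i j => by fun_prop) (fun i => by fun_prop) lam⟩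
    have hK : IsMarkovKernel K := ⟨hμ⟩
    have hρ := isProbabilityMeasure_sqrtSiteLaw hκ
    -- The new coordinate is `exp (-β_n)` with `β_n = u² + P n n / 2`.
    let E : ℝ → I := fun u => ⟨Real.exp (-u ^ 2 - P n n / 2), (Real.exp_pos _).le,
      Real.exp_le_one_iff.2 (by nlinarith [hP n n, sq_nonneg u])⟩
    have hE : Measurable E := Measurable.subtype_mk (by fun_prop)
    let F : ℝ × (V → I) → V → I := fun p => Function.update p.2 n (E p.1)
    have hF : Measurable F := measurable_pi_lambda _ fun i => by
      by_cases h : i = n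
      · subst h; simpa only [F, Function.update_self] using! hE.comp measurable_fst
      · simpa only [F, Function.update_of_ne h] using! (measurable_pi_apply i).comp measurable_snd
    refine ⟨(sqrtSiteLaw κ ⊗ₘ K).map F, Measure.isProbabilityMeasure_map hF.aemeasurable,
      fun lam => ?_⟩
    have hint : Integrable (fun p => mom lam (F p)) (sqrtSiteLaw κ ⊗ₘ K) :=
      .of_bound ((measurable_mom lam).comp hF).aestronglyMeasurable 1 (.of_forall fun p => by
        rw [Real.norm_of_nonneg (mom_nonneg lam _)]; exact mom_le_one lam _)
    rw [integral_map hF.aemeasurable (measurable_mom lam).aestronglyMeasurable,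
      Measure.integral_compProd hint]
    set x := sqrtShift lam with hx
    set l := ∑ i ∈ U, P n i * x i with hl
    have hl0 : 0 ≤ l := sum_nonneg fun i _ => mul_nonneg (hP n i) (sqrtShift_nonneg lam i)
    set c := Real.exp (-(lam n * (P n n / 2)) - quadExponent U P D x + l) *
      ∏ i ∈ U, (√(1 + (lam i : ℝ)))⁻¹ with hc
    have hinner : ∀ u, ∫ y, mom lam (F (u, y)) ∂K u =
        c * (Real.exp (-(lam n * u ^ 2)) *
          Real.exp (-((l ^ 2 + 2 * κ * l) / (4 * u ^ 2)))) := fun u => by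
      simp only [F, mom_update]
      rw [integral_const_mul]
      change _ * ∫ y, mom (lam.erase n) y ∂μ u = _
      rw [hmom, betaTransform_erase hn, betaTransform, hP', hD', quadExponent_rankOne, ← hx, ← hl,
        hc]
      simp only [E]
      rw [← Real.exp_mul, ← mul_assoc, mul_right_comm (Real.exp _) (∏ i ∈ U, _), ← Real.exp_add,
        ← Real.exp_add, mul_right_comm, ← Real.exp_add]
      congr 2
      ring
    simp only [hinner]
    rw [integral_const_mul, integral_sqrtSiteLaw_exp hκ hl0 (lam n).coe_nonneg, betaTransform,
      quadExponent_insert hn hsymm, ← hx, ← hl, prod_insert hn, hc]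
    have hxn : √(1 + (lam n : ℝ)) = 1 + x n := by simp [hx, sqrtShift]
    have hlam : (lam n : ℝ) = x n ^ 2 + 2 * x n := by
      have := Real.sq_sqrt (x := 1 + (lam n : ℝ)) (by positivity)
      rw [hxn] at this
      linarith
    have hexp : Real.exp (-(quadExponent U P D x + x n * l + 1 / 2 * P n n * x n ^ 2 + D n * x n)) =
        Real.exp (-(lam n * (P n n / 2)) - quadExponent U P D x + l) *
          Real.exp (κ - √(1 + (lam n : ℝ)) * (κ + l)) := by
      rw [← Real.exp_add, hxn, hlam, hκdef]
      congr 1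
      ring
    rw [hexp]
    ring

end Finite

end

/-! ### From finite volumes to the infinite graph. -/

section

open scoped NNReal unitInterval
open Finset Filter Topology

section Graph

variable {V : Type*}

theorem quadExponent_of_subset {S T : Finset V} (h : S ⊆ T) (P : V → V → ℝ) (D : V → ℝ)
    {x : V → ℝ} (hx : ∀ i ∈ T, i ∉ S → x i = 0) : quadExponent T P D x = quadExponent S P D x := by
  unfold quadExponent
  congr 1
  · congr 1
    rw [← sum_subset h fun i hi hiS => sum_eq_zero fun j _ => by rw [hx i hi hiS]; ring]
    exact sum_congr rfl fun i _ =>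
      (sum_subset h fun j hj hjS => by rw [hx j hj hjS, mul_zero]).symm
  · exact (sum_subset h fun i hi hiS => by rw [hx i hi hiS, mul_zero]).symm

/-- Consistency of finite volumes: where `λ_i = 0`, also `x_i = 0`, and the weights `D` do not
depend on the volume. -/
theorem betaTransform_of_support_subset {T : Finset V} {lam : V →₀ ℝ≥0} (h : lam.support ⊆ T)
    (P : V → V → ℝ) (D : V → ℝ) : betaTransform T P D lam = betaTransform lam.support P D lam := by
  unfold betaTransform
  rw [quadExponent_of_subset h P D fun i _ hi => sqrtShift_eq_zero (Finsupp.notMem_support_iff.1 hi),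
    ← prod_subset h fun i _ hi => by simp [Finsupp.notMem_support_iff.1 hi]]

variable (G : SimpleGraph V)

theorem cond_comm (W : G.edgeSet → ℝ) (i j : V) : cond G W i j = cond G W j i := by
  unfold cond
  by_cases h : G.Adj i j
  · rw [dif_pos h, dif_pos h.symm]
    congr 2
    exact Sym2.eq_swap
  · rw [dif_neg h, dif_neg fun h' => h h'.symm]

theorem cond_of_not_adj (W : G.edgeSet → ℝ) {i j : V} (h : ¬G.Adj i j) : cond G W i j = 0 :=
  dif_neg h

theorem cond_nonneg {W : G.edgeSet → ℝ} (hW : ∀ e, 0 < W e) (i j : V) : 0 ≤ cond G W i j := by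
  unfold cond
  split_ifs with h
  exacts [(hW _).le, le_rfl]

theorem measurable_cond (i j : V) : Measurable fun W : G.edgeSet → ℝ => cond G W i j := by
  unfold cond
  split_ifs with h
  exacts [measurable_pi_apply _, measurable_const]

variable [G.LocallyFinite]

/-- The sum of the conductances of the edges at a vertex. -/
noncomputable def totalWeight (W : G.edgeSet → ℝ) (i : V) : ℝ :=
  ∑ j ∈ G.neighborFinset i, cond G W i j

theorem measurable_totalWeight (i : V) : Measurable fun W : G.edgeSet → ℝ => totalWeight G W i :=
  measurable_sum _ fun j _ => measurable_cond G i j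

theorem sum_neighborFinset_filter_mem [DecidableEq V] (W : G.edgeSet → ℝ) (U : Finset V) (i : V) :
    ∑ j ∈ G.neighborFinset i with j ∈ U, cond G W i j = ∑ j ∈ U, cond G W i j := by
  refine sum_subset (fun j hj => (mem_filter.1 hj).2) fun j hj hj' => cond_of_not_adj G W fun h => ?_
  exact hj' (mem_filter.2 ⟨(G.mem_neighborFinset i j).2 h, hj⟩)

theorem sum_cond_le_totalWeight {W : G.edgeSet → ℝ} (hW : ∀ e, 0 < W e) (U : Finset V) (i : V) :
    ∑ j ∈ U, cond G W i j ≤ totalWeight G W i := by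
  classical
  rw [← sum_neighborFinset_filter_mem]
  exact sum_le_sum_of_subset_of_nonneg (filter_subset _ _) fun j _ _ => cond_nonneg G hW i j

/-- The linear terms `x_i + x_j` from edges inside `U` complete the boundary sum to the full weight
at each vertex. -/
theorem laplaceExponent_eq_quadExponent (W : G.edgeSet → ℝ) (U : Finset V) {lam : V → ℝ}
    (hlam : ∀ i ∈ U, 0 ≤ lam i) :
    laplaceExponent G W U lam =
      quadExponent U (cond G W) (totalWeight G W) fun i => √(1 + lam i) - 1 := by
  classical
  set x : V → ℝ := fun i => √(1 + lam i) - 1 with hx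
  have hs : ∀ i, √(1 + lam i) = 1 + x i := fun i => by simp [hx]
  have h2 : ∀ i ∈ U, ∑ j ∈ G.neighborFinset i with j ∉ U, cond G W i j * (√(1 + lam i) - 1) =
      totalWeight G W i * x i - ∑ j ∈ U, cond G W i j * x i := fun i _ => by
    rw [← sum_mul, ← sum_mul, totalWeight,
      ← sum_filter_add_sum_filter_not (G.neighborFinset i) (· ∈ U),
      sum_neighborFinset_filter_mem]
    ring
  have h1 : ∀ i ∈ U, ∀ j ∈ U, cond G W i j * (√((1 + lam i) * (1 + lam j)) - 1) =
      cond G W i j * x i * x j + cond G W i j * x i + cond G W i j * x j := fun i hi j _ => by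
    rw [Real.sqrt_mul (by linarith [hlam i hi]), hs, hs]
    ring
  have h3 : ∑ i ∈ U, ∑ j ∈ U, cond G W i j * x j = ∑ i ∈ U, ∑ j ∈ U, cond G W i j * x i := by
    rw [sum_comm]
    exact sum_congr rfl fun i _ => sum_congr rfl fun j _ => by rw [cond_comm]
  unfold laplaceExponent quadExponent
  rw [sum_congr rfl fun i hi => sum_congr rfl (h1 i hi)]
  convert_to _ + ∑ i ∈ U, ∑ j ∈ G.neighborFinset i with j ∉ U,
    cond G W i j * (√(1 + lam i) - 1) = _
  rw [sum_congr rfl h2]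
  simp only [sum_add_distrib, sum_sub_distrib, h3]
  ring

/-- The moments on the cube of the random potential of the graph, in the variables
`y_i = exp (-β_i)`. -/
noncomputable def graphTransform (W : G.edgeSet → ℝ) (lam : V →₀ ℝ≥0) : ℝ :=
  betaTransform lam.support (cond G W) (totalWeight G W) lam

theorem measurable_graphTransform (lam : V →₀ ℝ≥0) :
    Measurable fun W : G.edgeSet → ℝ => graphTransform G W lam :=
  measurable_betaTransform _ (measurable_cond G) (measurable_totalWeight G) lam

theorem exp_neg_laplaceExponent_mul (W : G.edgeSet → ℝ) {U : Finset V} {lam : V → ℝ}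
    {lam' : V →₀ ℝ≥0} (hU : lam'.support ⊆ U) (h : ∀ i ∈ U, (lam' i : ℝ) = lam i) :
    Real.exp (-laplaceExponent G W U lam) * (1 / ∏ i ∈ U, √(1 + lam i)) =
      graphTransform G W lam' := by
  rw [graphTransform, ← betaTransform_of_support_subset hU, betaTransform,
    laplaceExponent_eq_quadExponent G W U fun i hi => h i hi ▸ (lam' i).coe_nonneg, one_div,
    ← prod_inv_distrib]
  have hx : ∀ i ∈ U, √(1 + lam i) - 1 = sqrtShift lam' i := fun i hi => by
    rw [sqrtShift, h i hi]
  congr 1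
  · rw [quadExponent_congr (fun _ _ _ _ => rfl) (fun _ _ => rfl) hx]
  · exact prod_congr rfl fun i hi => by rw [h i hi]

theorem graphTransform_single (W : G.edgeSet → ℝ) (i : V) (a : ℝ≥0) :
    graphTransform G W (Finsupp.single i a) =
      Real.exp (-(totalWeight G W i * (√(1 + (a : ℝ)) - 1))) * (√(1 + (a : ℝ)))⁻¹ := by
  rw [graphTransform, ← betaTransform_of_support_subset Finsupp.support_single_subset]
  simp [betaTransform, quadExponent, sqrtShift, cond_of_not_adj G W (G.loopless.irrefl i)]

theorem exists_measure_integral_mom_eq_graphTransform [Countable V] {W : G.edgeSet → ℝ}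
    (hW : ∀ e, 0 < W e) : ∃ μ : Measure (V → I), IsProbabilityMeasure μ ∧
      ∀ lam, ∫ y, mom lam y ∂μ = graphTransform G W lam := by
  have hex := fun U : Finset V => exists_measure_integral_mom_eq_betaTransform U (cond G W)
    (totalWeight G W) (cond_nonneg G hW) (cond_comm G W)
    fun i _ => sum_cond_le_totalWeight G hW U i
  choose μ hμ hmom using hex
  -- Probability measures on the cube form a compact space, so the finite-volume laws converge along
  -- an ultrafilter. Each moment is constant once the volume contains its support.
  let F : Ultrafilter (Finset V) := Ultrafilter.of atTop
  let m : Finset V → ProbabilityMeasure (V → I) := fun U => ⟨μ U, hμ U⟩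
  have hlim : Tendsto m F (𝓝 (F.map m).lim) := (F.map m).le_nhds_lim
  refine ⟨(F.map m).lim, inferInstance, fun lam => ?_⟩
  have h1 := ((ProbabilityMeasure.continuous_integral_continuousMap
    (momHom V (.ofAdd lam))).tendsto _).comp hlim
  refine tendsto_nhds_unique h1 (tendsto_const_nhds.congr' ?_)
  refine Ultrafilter.of_le atTop ?_
  filter_upwards [eventually_ge_atTop lam.support] with U hU
  exact ((hmom U lam).trans (betaTransform_of_support_subset hU _ _)).symm

/-- Letting the exponent tend to 0 in `y_i^a ≤ 1_{y_i > 0}` rules out `y_i = 0`; letting it tend to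
infinity in `1_{y_i = 1} ≤ y_i^a` rules out `y_i = 1`. -/
theorem ae_mem_Ioo_of_integral_mom [Countable V] {W : G.edgeSet → ℝ} (hW : ∀ e, 0 < W e)
    {μ : Measure (V → I)} [IsProbabilityMeasure μ]
    (h : ∀ lam, ∫ y, mom lam y ∂μ = graphTransform G W lam) :
    ∀ᵐ y ∂μ, ∀ i, (y i : ℝ) ∈ Set.Ioo (0 : ℝ) 1 := by
  refine ae_all_iff.2 fun i => ?_
  have hmeas : Measurable fun y : V → I => (y i : ℝ) :=
    measurable_subtype_coe.comp (measurable_pi_apply i)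
  have hD : 0 ≤ totalWeight G W i := sum_nonneg fun j _ => cond_nonneg G hW i j
  have hsingle : ∀ a : ℝ≥0, ∫ y, (y i : ℝ) ^ (a : ℝ) ∂μ =
      Real.exp (-(totalWeight G W i * (√(1 + (a : ℝ)) - 1))) * (√(1 + (a : ℝ)))⁻¹ := fun a => by
    simpa only [mom_single, graphTransform_single] using h (Finsupp.single i a)
  have hint : ∀ a : ℝ≥0, Integrable (fun y => (y i : ℝ) ^ (a : ℝ)) μ := fun a =>
    (integrable_mom (Finsupp.single i a) μ).congr (.of_forall (mom_single i a))
  have hpos : ∀ᵐ y ∂μ, (0 : ℝ) < y i := by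
    have hset : MeasurableSet {y : V → I | (0 : ℝ) < y i} := measurableSet_lt measurable_const hmeas
    have hle : ∀ n : ℕ, Real.exp (-(totalWeight G W i * (√(1 + 1 / ((n : ℝ) + 1)) - 1))) *
        (√(1 + 1 / ((n : ℝ) + 1)))⁻¹ ≤ μ.real {y : V → I | (0 : ℝ) < y i} := fun n => by
      have h1 := hsingle (1 / ((n : ℝ≥0) + 1))
      push_cast at h1
      rw [← h1, ← integral_indicator_one hset]
      refine integral_mono (by simpa using hint (1 / ((n : ℝ≥0) + 1)))
        ((integrable_const (1 : ℝ)).indicator hset) fun y => ?_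
      by_cases hy : (0 : ℝ) < y i
      · rw [Set.indicator_of_mem (by exact hy)]
        exact Real.rpow_le_one (y i).2.1 (y i).2.2 (by positivity)
      · rw [Set.indicator_of_notMem (by exact hy)]
        have : (y i : ℝ) = 0 := le_antisymm (not_lt.1 hy) (y i).2.1
        simp only [this]
        rw [Real.zero_rpow (by positivity)]
    have hlim : Tendsto (fun n : ℕ => Real.exp (-(totalWeight G W i *
        (√(1 + 1 / ((n : ℝ) + 1)) - 1))) * (√(1 + 1 / ((n : ℝ) + 1)))⁻¹) atTop (𝓝 1) := by
      have hc : ContinuousAt (fun t : ℝ => Real.exp (-(totalWeight G W i * (√(1 + t) - 1))) *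
          (√(1 + t))⁻¹) 0 := by
        refine ContinuousAt.mul (by fun_prop) (ContinuousAt.inv₀ (by fun_prop) (by simp))
      simpa [Function.comp_def] using hc.tendsto.comp (tendsto_one_div_add_atTop_nhds_zero_nat (𝕜 := ℝ))
    have h1 : μ.real {y : V → I | (0 : ℝ) < y i} = 1 :=
      le_antisymm measureReal_le_one (le_of_tendsto' hlim hle)
    exact (prob_compl_eq_zero_iff hset).2 ((ENNReal.toReal_eq_one_iff _).1 h1)
  have hlt : ∀ᵐ y ∂μ, (y i : ℝ) < 1 := by
    have hset : MeasurableSet {y : V → I | (y i : ℝ) = 1} := hmeas (measurableSet_singleton 1)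
    have hle : ∀ n : ℕ, μ.real {y : V → I | (y i : ℝ) = 1} ≤ (√(1 + (n : ℝ)))⁻¹ := fun n => by
      have h1 := hsingle n
      push_cast at h1
      have h2 : ∫ y, (y i : ℝ) ^ (n : ℝ) ∂μ ≤ (√(1 + (n : ℝ)))⁻¹ := by
        rw [h1]
        refine mul_le_of_le_one_left (by positivity) (Real.exp_le_one_iff.2 ?_)
        exact neg_nonpos.2 (mul_nonneg hD (sub_nonneg.2 (Real.one_le_sqrt.2 (by simp))))
      refine le_trans ?_ h2
      rw [← integral_indicator_one hset]
      refine integral_mono ((integrable_const (1 : ℝ)).indicator hset)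
        (by simpa using hint n) fun y => ?_
      by_cases hy : (y i : ℝ) = 1
      · rw [Set.indicator_of_mem (by exact hy)]
        simp [hy]
      · rw [Set.indicator_of_notMem (by exact hy)]
        exact Real.rpow_nonneg (y i).2.1 _
    have hlim : Tendsto (fun n : ℕ => (√(1 + (n : ℝ)))⁻¹) atTop (𝓝 0) :=
      (Real.tendsto_sqrt_atTop.comp
        (tendsto_atTop_add_const_left _ 1 tendsto_natCast_atTop_atTop)).inv_tendsto_atTop
    have h1 : μ.real {y : V → I | (y i : ℝ) = 1} = 0 :=
      le_antisymm (ge_of_tendsto' hlim hle) measureReal_nonneg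
    have h2 : ∀ᵐ y ∂μ, ¬(y i : ℝ) = 1 :=
      measure_eq_zero_iff_ae_notMem.1 ((measureReal_eq_zero_iff).1 h1)
    filter_upwards [h2] with y hy
    exact lt_of_le_of_ne (y i).2.2 hy
  filter_upwards [hpos, hlt] with y h1 h2 using ⟨h1, h2⟩

end Graph

end

/-! ### Back to positive fields, and the kernel in `W`. -/

section

open scoped NNReal unitInterval
open Finset Filter Topology

section Transport

variable {V : Type*}

/-- The change of variables `β_i = -log y_i`. -/
noncomputable def negLog (y : V → I) (i : V) : ℝ := -Real.log (y i)

/-- The change of variables `y_i = exp (-β_i)`, for `β_i ≥ 0`. -/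
noncomputable def expNeg (β : V → ℝ) (i : V) : I :=
  ⟨Real.exp (-max (β i) 0), (Real.exp_pos _).le,
    Real.exp_le_one_iff.2 (neg_nonpos.2 (le_max_right _ _))⟩

theorem measurable_negLog : Measurable (negLog (V := V)) :=
  measurable_pi_lambda _ fun i =>
    (Real.measurable_log.comp (measurable_subtype_coe.comp (measurable_pi_apply i))).neg

theorem measurable_expNeg : Measurable (expNeg (V := V)) :=
  measurable_pi_lambda _ fun i => Measurable.subtype_mk
    (Real.measurable_exp.comp ((measurable_pi_apply i).max measurable_const).neg)

theorem negLog_expNeg {β : V → ℝ} (h : ∀ i, 0 < β i) : negLog (expNeg β) = β := by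
  ext i
  simp [negLog, expNeg, (h i).le]

theorem mom_eq_exp_negLog {y : V → I} (hy : ∀ i, (0 : ℝ) < y i) {U : Finset V} {lam : V → ℝ}
    {lam' : V →₀ ℝ≥0} (hU : lam'.support ⊆ U) (h : ∀ i ∈ U, (lam' i : ℝ) = lam i) :
    mom lam' y = Real.exp (-∑ i ∈ U, lam i * negLog y i) := by
  rw [mom_eq_prod_of_subset hU, ← sum_neg_distrib, Real.exp_sum]
  refine prod_congr rfl fun i hi => ?_
  rw [Real.rpow_def_of_pos (hy i), h i hi, negLog]
  congr 1
  ring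

variable [Countable V] (G : SimpleGraph V) [G.LocallyFinite]

theorem isBetaLaw_map_negLog {W : G.edgeSet → ℝ} (hW : ∀ e, 0 < W e) {μ : Measure (V → I)}
    [IsProbabilityMeasure μ] (h : ∀ lam, ∫ y, mom lam y ∂μ = graphTransform G W lam) :
    IsBetaLaw G W (μ.map negLog) where
  isProbabilityMeasure := Measure.isProbabilityMeasure_map measurable_negLog.aemeasurable
  pos i := by
    rw [ae_map_iff measurable_negLog.aemeasurable
      (measurableSet_lt measurable_const (measurable_pi_apply i))]
    filter_upwards [ae_mem_Ioo_of_integral_mom G hW h] with y hy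
    exact neg_pos.2 (Real.log_neg (hy i).1 (hy i).2)
  laplace U lam hlam := by
    classical
    -- `lam` is nonnegative only on `U`, so it is cut off outside.
    let lam' : V →₀ ℝ≥0 := Finsupp.onFinset U (fun i => if i ∈ U then (lam i).toNNReal else 0)
      fun i hi => by by_contra h; simp [h] at hi
    have hU : lam'.support ⊆ U := Finsupp.support_onFinset_subset
    have hl : ∀ i ∈ U, (lam' i : ℝ) = lam i := fun i hi => by
      simp [lam', hi, hlam i hi]
    have hm : Measurable fun β : V → ℝ => Real.exp (-∑ i ∈ U, lam i * β i) :=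
      Real.measurable_exp.comp
        (measurable_sum _ fun i _ => (measurable_pi_apply i).const_mul _).neg
    rw [exp_neg_laplaceExponent_mul G W hU hl, ← h,
      integral_map measurable_negLog.aemeasurable hm.aestronglyMeasurable]
    refine integral_congr_ae ?_
    filter_upwards [ae_mem_Ioo_of_integral_mom G hW h] with y hy
    exact (mom_eq_exp_negLog (fun i => (hy i).1) hU hl).symm

theorem IsBetaLaw.ae_pos {G : SimpleGraph V} [G.LocallyFinite] {W : G.edgeSet → ℝ}
    {μ : Measure (V → ℝ)} (h : IsBetaLaw G W μ) : ∀ᵐ β ∂μ, ∀ i, 0 < β i :=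
  ae_all_iff.2 h.pos

theorem IsBetaLaw.integral_mom_map_expNeg {G : SimpleGraph V} [G.LocallyFinite]
    {W : G.edgeSet → ℝ} {μ : Measure (V → ℝ)} (h : IsBetaLaw G W μ) (lam : V →₀ ℝ≥0) :
    ∫ y, mom lam y ∂μ.map expNeg = graphTransform G W lam := by
  rw [integral_map measurable_expNeg.aemeasurable (measurable_mom lam).aestronglyMeasurable,
    ← exp_neg_laplaceExponent_mul G W subset_rfl fun i _ => rfl,
    ← h.laplace _ _ fun i _ => (lam i).coe_nonneg]
  refine integral_congr_ae ?_
  filter_upwards [h.ae_pos] with β hβ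
  rw [mom_eq_exp_negLog (fun i => Real.exp_pos _) subset_rfl fun i _ => rfl, negLog_expNeg hβ]

/-- Uniqueness: the Laplace transforms fix the moments of `exp (-β)`, and the logarithm recovers `β`
on positive fields. -/
theorem IsBetaLaw.eq_map_negLog {G : SimpleGraph V} [G.LocallyFinite] {W : G.edgeSet → ℝ}
    {ν : Measure (V → ℝ)} (hν : IsBetaLaw G W ν) {μ : Measure (V → I)} [IsProbabilityMeasure μ]
    (h : ∀ lam, ∫ y, mom lam y ∂μ = graphTransform G W lam) : ν = μ.map negLog := by
  have := hν.isProbabilityMeasure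
  have : IsProbabilityMeasure (ν.map expNeg) :=
    Measure.isProbabilityMeasure_map measurable_expNeg.aemeasurable
  have h1 : ν.map expNeg = μ :=
    ext_of_integral_mom fun lam => (hν.integral_mom_map_expNeg lam).trans (h lam).symm
  rw [← h1, Measure.map_map measurable_negLog measurable_expNeg]
  have h2 : negLog ∘ expNeg =ᵐ[ν] id := by
    filter_upwards [hν.ae_pos] with β hβ using negLog_expNeg hβ
  rw [Measure.map_congr h2, Measure.map_id]

open Classical in
/-- The law of `exp (-β)` as a function of the conductances, extended by a constant to conductances
that are not positive. -/
noncomputable def cubeLaw (W : G.edgeSet → ℝ) : Measure (V → I) :=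
  if h : ∀ e, 0 < W e then (exists_measure_integral_mom_eq_graphTransform G h).choose
  else Measure.dirac 1

theorem integral_mom_cubeLaw {W : G.edgeSet → ℝ} (hW : ∀ e, 0 < W e) (lam : V →₀ ℝ≥0) :
    ∫ y, mom lam y ∂cubeLaw G W = graphTransform G W lam := by
  rw [cubeLaw, dif_pos hW]
  exact (exists_measure_integral_mom_eq_graphTransform G hW).choose_spec.2 lam

instance isProbabilityMeasure_cubeLaw (W : G.edgeSet → ℝ) :
    IsProbabilityMeasure (cubeLaw G W) := by
  unfold cubeLaw
  split_ifs with h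
  · exact (exists_measure_integral_mom_eq_graphTransform G h).choose_spec.1
  · infer_instance

theorem measurable_cubeLaw : Measurable (cubeLaw G) := by
  classical
  refine measurable_of_integral_mom fun lam => ?_
  have h : (fun W => ∫ y, mom lam y ∂cubeLaw G W) = fun W =>
      if ∀ e, 0 < W e then graphTransform G W lam else mom lam 1 := by
    ext W
    split_ifs with hW
    · exact integral_mom_cubeLaw G hW lam
    · rw [cubeLaw, dif_neg hW]
      exact integral_dirac' _ _ (measurable_mom lam).stronglyMeasurable
  rw [h]
  refine Measurable.ite ?_ (measurable_graphTransform G lam) measurable_const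
  have : {W : G.edgeSet → ℝ | ∀ e, 0 < W e} = ⋂ e, {W | 0 < W e} := by ext; simp
  rw [this]
  exact MeasurableSet.iInter fun e => measurableSet_lt measurable_const (measurable_pi_apply e)

/-- `cubeLaw` as a Markov kernel. -/
noncomputable def cubeKernel : Kernel (G.edgeSet → ℝ) (V → I) := ⟨cubeLaw G, measurable_cubeLaw G⟩

instance isMarkovKernel_cubeKernel : IsMarkovKernel (cubeKernel G) :=
  ⟨isProbabilityMeasure_cubeLaw G⟩

end Transport

/-! ### Independence from factorizing moments. -/

section Independence

variable {V : Type*}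

open Classical in
/-- The point of the cube that is `y` on `U`, `z` on `U' \ U`, and `1` elsewhere. -/
noncomputable def glue (U U' : Set V) (p : (V → I) × (V → I)) (i : V) : I :=
  if i ∈ U then p.1 i else if i ∈ U' then p.2 i else 1

theorem measurable_glue (U U' : Set V) : Measurable (glue U U') :=
  measurable_pi_lambda _ fun i => by
    unfold glue
    split_ifs
    · exact (measurable_pi_apply i).comp measurable_fst
    · exact (measurable_pi_apply i).comp measurable_snd
    · exact measurable_const

theorem mom_glue {U U' : Set V} [DecidablePred (· ∈ U)] [DecidablePred (· ∈ U')]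
    (hUU' : Disjoint U U') (lam : V →₀ ℝ≥0) (y z : V → I) :
    mom lam (glue U U' (y, z)) = mom (lam.filter (· ∈ U)) y * mom (lam.filter (· ∈ U')) z := by
  rw [mom_eq_prod_of_subset subset_rfl, mom_eq_prod_of_subset (T := lam.support) (filter_subset _ _),
    mom_eq_prod_of_subset (T := lam.support) (filter_subset _ _), ← prod_mul_distrib]
  refine prod_congr rfl fun i _ => ?_
  unfold glue
  by_cases hi : i ∈ U
  · simp [hi, Set.disjoint_left.1 hUU' hi]
  · by_cases hi' : i ∈ U' <;> simp [hi, hi']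

/-- Restrictions of a random point of the cube to disjoint sets of coordinates are independent as
soon as the moments factorize. -/
theorem indepFun_restrict_of_integral_mom [Countable V] {U U' : Set V} (hUU' : Disjoint U U')
    {m : Measure (V → I)} [IsProbabilityMeasure m]
    (h : ∀ lam lam' : V →₀ ℝ≥0, (∀ i ∈ lam.support, i ∈ U) → (∀ i ∈ lam'.support, i ∈ U') →
      ∫ y, mom (lam + lam') y ∂m = (∫ y, mom lam y ∂m) * ∫ y, mom lam' y ∂m) :
    IndepFun U.domRestrict U'.domRestrict m := by
  classical
  have hg : Measurable fun y : V → I => glue U U' (y, y) :=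
    (measurable_glue U U').comp (measurable_id.prodMk measurable_id)
  have hR : Measurable fun y : V → I => (U.domRestrict y, U'.domRestrict y) :=
    (measurable_pi_lambda _ fun i => measurable_pi_apply _).prodMk
      (measurable_pi_lambda _ fun i => measurable_pi_apply _)
  have hU : Measurable (U.domRestrict : (V → I) → _) := hR.fst
  have hU' : Measurable (U'.domRestrict : (V → I) → _) := hR.snd
  have := Measure.isProbabilityMeasure_map (μ := m) hg.aemeasurable
  have := Measure.isProbabilityMeasure_map (μ := m.prod m) (measurable_glue U U').aemeasurable
  -- One point used twice and two independent points glue to the same law. Filling the other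
  -- coordinates with 1 reduces every moment to exponents supported in `U` and `U'`.
  have key : m.map (fun y => glue U U' (y, y)) = (m.prod m).map (glue U U') := by
    refine ext_of_integral_mom fun lam => ?_
    rw [integral_map hg.aemeasurable (measurable_mom lam).aestronglyMeasurable,
      integral_map (measurable_glue U U').aemeasurable (measurable_mom lam).aestronglyMeasurable]
    have h1 : ∀ p : (V → I) × (V → I), mom lam (glue U U' p) =
        mom (lam.filter (· ∈ U)) p.1 * mom (lam.filter (· ∈ U')) p.2 :=
      fun p => mom_glue hUU' lam p.1 p.2
    simp only [h1]
    rw [integral_prod_mul, ← h _ _ (fun i hi => (mem_filter.1 hi).2)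
      fun i hi => (mem_filter.1 hi).2]
    simp only [mom_add]
  have hglue : ∀ y z : V → I, U.domRestrict (glue U U' (y, z)) = U.domRestrict y ∧
      U'.domRestrict (glue U U' (y, z)) = U'.domRestrict z := fun y z => by
    constructor
    · funext i
      exact if_pos i.2
    · funext i
      exact (if_neg (Set.disjoint_right.1 hUU' i.2)).trans (if_pos i.2)
  rw [indepFun_iff_map_prod_eq_prod_map_map hU.aemeasurable hU'.aemeasurable,
    Measure.map_prod_map _ _ hU hU']
  calc m.map (fun y => (U.domRestrict y, U'.domRestrict y))
      = (m.map fun y => glue U U' (y, y)).map fun y => (U.domRestrict y, U'.domRestrict y) := by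
        rw [Measure.map_map hR hg]
        congr 1
        ext1 y
        simp only [Function.comp_apply, hglue]
    _ = (m.prod m).map (Prod.map U.domRestrict U'.domRestrict) := by
        rw [key, Measure.map_map hR (measurable_glue U U')]
        congr 1
        ext1 p
        exact Prod.ext (hglue p.1 p.2).1 (hglue p.1 p.2).2

end Independence

end

/-! ### Averaging over independent conductances. -/

section

open scoped NNReal unitInterval
open Finset Filter Topology

section Mixture

variable {V : Type*} (G : SimpleGraph V)

theorem quadExponent_union [DecidableEq V] {T T' : Finset V} (hT : Disjoint T T')
    {P : V → V → ℝ} (hP : ∀ i ∈ T, ∀ j ∈ T', P i j = 0 ∧ P j i = 0) (D x : V → ℝ) :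
    quadExponent (T ∪ T') P D x = quadExponent T P D x + quadExponent T' P D x := by
  have h1 : ∑ i ∈ T, ∑ j ∈ T', P i j * x i * x j = 0 :=
    sum_eq_zero fun i hi => sum_eq_zero fun j hj => by rw [(hP i hi j hj).1]; ring
  have h2 : ∑ i ∈ T', ∑ j ∈ T, P i j * x i * x j = 0 :=
    sum_eq_zero fun i hi => sum_eq_zero fun j hj => by rw [(hP j hj i hi).2]; ring
  simp only [quadExponent, sum_union hT, sum_add_distrib, h1, h2]
  ring

open Classical in
/-- Extension by zero of conductances defined on a finite set of edges. -/
noncomputable def extendConductances (S : Finset G.edgeSet) (w : S → ℝ) (e : G.edgeSet) : ℝ :=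
  if h : e ∈ S then w ⟨e, h⟩ else 0

theorem measurable_extendConductances (S : Finset G.edgeSet) :
    Measurable (extendConductances G S) :=
  measurable_pi_lambda _ fun e => by
    unfold extendConductances
    split_ifs
    exacts [measurable_pi_apply _, measurable_const]

section LocallyFinite

variable [G.LocallyFinite]

theorem graphTransform_add {lam lam' : V →₀ ℝ≥0}
    (h : ∀ i ∈ lam.support, ∀ j ∈ lam'.support, i ≠ j ∧ ¬G.Adj i j) (W : G.edgeSet → ℝ) :
    graphTransform G W (lam + lam') = graphTransform G W lam * graphTransform G W lam' := by
  classical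
  have hdisj : Disjoint lam.support lam'.support :=
    Finset.disjoint_left.2 fun i hi hi' => (h i hi i hi').1 rfl
  have h1 : ∀ i ∈ lam.support, (lam + lam') i = lam i := fun i hi => by
    simp [Finsupp.notMem_support_iff.1 (Finset.disjoint_left.1 hdisj hi)]
  have h2 : ∀ i ∈ lam'.support, (lam + lam') i = lam' i := fun i hi => by
    simp [Finsupp.notMem_support_iff.1 (Finset.disjoint_right.1 hdisj hi)]
  rw [graphTransform, ← betaTransform_of_support_subset Finsupp.support_add, graphTransform,
    graphTransform, betaTransform, quadExponent_union hdisj fun i hi j hj =>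
      ⟨cond_of_not_adj G W (h i hi j hj).2, cond_of_not_adj G W fun h' => (h i hi j hj).2 h'.symm⟩,
    prod_union hdisj, neg_add, Real.exp_add, betaTransform, betaTransform,
    prod_congr rfl fun i hi => by rw [h1 i hi],
    prod_congr (s₁ := lam'.support) rfl fun i hi => by rw [h2 i hi],
    quadExponent_congr (U := lam.support) (fun _ _ _ _ => rfl) (fun _ _ => rfl)
      (x' := sqrtShift lam) fun i hi => by rw [sqrtShift, h1 i hi, sqrtShift],
    quadExponent_congr (U := lam'.support) (fun _ _ _ _ => rfl) (fun _ _ => rfl)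
      (x' := sqrtShift lam') fun i hi => by rw [sqrtShift, h2 i hi, sqrtShift]]
  ring

open Classical in
/-- The edges with an endpoint in `T`. -/
noncomputable def edgesAt (T : Finset V) : Finset G.edgeSet :=
  T.biUnion fun i => (G.neighborFinset i).attach.image fun j : G.neighborFinset i =>
    ⟨s(i, j.1), (G.mem_neighborFinset i j).1 j.2⟩

theorem mem_edgesAt {T : Finset V} {e : G.edgeSet} :
    e ∈ edgesAt G T ↔ ∃ i ∈ T, ∃ j, G.Adj i j ∧ (e : Sym2 V) = s(i, j) := by
  classical
  simp only [edgesAt, mem_biUnion, mem_image, mem_attach, true_and, Subtype.exists,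
    SimpleGraph.mem_neighborFinset, Subtype.ext_iff]
  exact ⟨fun ⟨i, hi, j, hj, he⟩ => ⟨i, hi, j, hj, he.symm⟩,
    fun ⟨i, hi, j, hj, he⟩ => ⟨i, hi, j, hj, he.symm⟩⟩

/-- A common edge would have an endpoint in each set, and two endpoints of one edge are equal or
adjacent. -/
theorem disjoint_edgesAt {T T' : Finset V} (h : ∀ i ∈ T, ∀ j ∈ T', i ≠ j ∧ ¬G.Adj i j) :
    Disjoint (edgesAt G T) (edgesAt G T') := by
  refine Finset.disjoint_left.2 fun e he he' => ?_
  obtain ⟨i, hi, j, hij, hs⟩ := (mem_edgesAt G).1 he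
  obtain ⟨i', hi', j', hij', hs'⟩ := (mem_edgesAt G).1 he'
  rw [hs, Sym2.eq_iff] at hs'
  rcases hs' with ⟨rfl, _⟩ | ⟨_, rfl⟩
  · exact (h _ hi _ hi').1 rfl
  · exact (h _ hi _ hi').2 hij

/-- Exhibits the transform as a function of finitely many conductances, the form to which
independence of disjoint subfamilies applies. -/
theorem graphTransform_extendConductances (W : G.edgeSet → ℝ) (lam : V →₀ ℝ≥0) :
    graphTransform G (extendConductances G (edgesAt G lam.support) fun e => W e) lam =
      graphTransform G W lam := by
  have hc : ∀ i ∈ lam.support, ∀ j,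
      cond G (extendConductances G (edgesAt G lam.support) fun e => W e) i j = cond G W i j := by
    intro i hi j
    unfold cond
    split_ifs with h
    · exact dif_pos ((mem_edgesAt G).2 ⟨i, hi, j, h, rfl⟩)
    · rfl
  unfold graphTransform betaTransform
  rw [quadExponent_congr (D := totalWeight G _) (D' := totalWeight G W)
    (fun i hi j _ => hc i hi j)
    (fun i hi => sum_congr rfl fun j _ => hc i hi j) fun _ _ => rfl]

theorem indepFun_graphTransform {a : G.edgeSet → ℝ} (ha : ∀ e, 0 < a e) {lam lam' : V →₀ ℝ≥0}
    (h : ∀ i ∈ lam.support, ∀ j ∈ lam'.support, i ≠ j ∧ ¬G.Adj i j) :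
    IndepFun (fun W => graphTransform G W lam) (fun W => graphTransform G W lam')
      (gammaConductances G a) := by
  have hp : ∀ e, IsProbabilityMeasure (gammaMeasure (a e) 1) := fun e =>
    isProbabilityMeasure_gammaMeasure (ha e) one_pos
  have hi : iIndepFun (fun (e : G.edgeSet) (W : G.edgeSet → ℝ) => W e) (gammaConductances G a) :=
    iIndepFun_infinitePi (P := fun e => gammaMeasure (a e) 1) (X := fun _ w => w)
      fun _ => measurable_id
  have h1 := (hi.indepFun_finset _ _ (disjoint_edgesAt G h) fun e => measurable_pi_apply e).comp
    ((measurable_graphTransform G lam).comp (measurable_extendConductances G _))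
    ((measurable_graphTransform G lam').comp (measurable_extendConductances G _))
  simpa only [Function.comp_def, graphTransform_extendConductances] using! h1

end LocallyFinite

theorem isProbabilityMeasure_gammaConductances {a : G.edgeSet → ℝ} (ha : ∀ e, 0 < a e) :
    IsProbabilityMeasure (gammaConductances G a) := by
  have hp : ∀ e, IsProbabilityMeasure (gammaMeasure (a e) 1) := fun e =>
    isProbabilityMeasure_gammaMeasure (ha e) one_pos
  unfold gammaConductances
  infer_instance

theorem ae_pos_gammaMeasure (a r : ℝ) : ∀ᵐ x ∂gammaMeasure a r, 0 < x := by
  rw [gammaMeasure, ae_withDensity_iff (by exact (measurable_gammaPDFReal a r).ennreal_ofReal)]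
  have h0 : ∀ᵐ x : ℝ, x ≠ 0 := by simp [ae_iff]
  filter_upwards [h0] with x hx hpdf
  refine lt_of_le_of_ne (not_lt.1 fun h => hpdf (gammaPDF_of_neg h)) hx.symm

variable [Countable V]

theorem ae_pos_gammaConductances {a : G.edgeSet → ℝ} (ha : ∀ e, 0 < a e) :
    ∀ᵐ W ∂gammaConductances G a, ∀ e, 0 < W e := by
  have hp : ∀ e, IsProbabilityMeasure (gammaMeasure (a e) 1) := fun e =>
    isProbabilityMeasure_gammaMeasure (ha e) one_pos
  have : Countable G.edgeSet := Subtype.countable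
  refine ae_all_iff.2 fun e => ?_
  exact (measurePreserving_eval_infinitePi (fun e => gammaMeasure (a e) 1) e).quasiMeasurePreserving.ae
    (ae_pos_gammaMeasure (a e) 1)

variable [G.LocallyFinite]

theorem integral_mom_cubeKernel_comp {a : G.edgeSet → ℝ} (ha : ∀ e, 0 < a e) (lam : V →₀ ℝ≥0) :
    ∫ y, mom lam y ∂(cubeKernel G ∘ₘ gammaConductances G a) =
      ∫ W, graphTransform G W lam ∂gammaConductances G a := by
  have := isProbabilityMeasure_gammaConductances G ha
  have hint : Integrable (fun p : (G.edgeSet → ℝ) × (V → I) => mom lam p.2)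
      (gammaConductances G a ⊗ₘ cubeKernel G) :=
    .of_bound ((measurable_mom lam).comp measurable_snd).aestronglyMeasurable 1
      (.of_forall fun p => by
        rw [Real.norm_of_nonneg (mom_nonneg lam _)]; exact mom_le_one lam _)
  rw [← Measure.snd_compProd, Measure.snd, integral_map measurable_snd.aemeasurable
    (measurable_mom lam).aestronglyMeasurable, Measure.integral_compProd hint]
  refine integral_congr_ae ?_
  filter_upwards [ae_pos_gammaConductances G ha] with W hW
  exact integral_mom_cubeLaw G hW lam

theorem indepFun_restrict_cubeKernel_comp {a : G.edgeSet → ℝ} (ha : ∀ e, 0 < a e) {U U' : Set V}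
    (h : ∀ i ∈ U, ∀ j ∈ U', i ≠ j ∧ ¬G.Adj i j) :
    IndepFun U.domRestrict U'.domRestrict (cubeKernel G ∘ₘ gammaConductances G a) := by
  have := isProbabilityMeasure_gammaConductances G ha
  refine indepFun_restrict_of_integral_mom
    (Set.disjoint_left.2 fun i hi hi' => (h i hi i hi').1 rfl) fun lam lam' hl hl' => ?_
  have h' : ∀ i ∈ lam.support, ∀ j ∈ lam'.support, i ≠ j ∧ ¬G.Adj i j :=
    fun i hi j hj => h i (hl i hi) j (hl' j hj)
  simp only [integral_mom_cubeKernel_comp G ha, graphTransform_add G h']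
  exact (indepFun_graphTransform G ha h').integral_fun_mul_eq_mul_integral
    (measurable_graphTransform G lam).aestronglyMeasurable
    (measurable_graphTransform G lam').aestronglyMeasurable

end Mixture

/-- Iterated neighbourhoods of one vertex are finite, and walks from it reach every vertex. -/
theorem countable_of_connected_of_locallyFinite {V : Type*} {G : SimpleGraph V} [G.LocallyFinite]
    (hG : G.Connected) : Countable V := by
  classical
  obtain ⟨v₀⟩ := hG.nonempty
  let S : ℕ → Finset V := fun n => (fun T : Finset V => T.biUnion fun i => G.neighborFinset i)^[n] {v₀}
  have hS : ∀ {u v : V} (p : G.Walk u v), (∃ n, u ∈ S n) → ∃ n, v ∈ S n := by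
    intro u v p
    induction p with
    | nil => exact id
    | cons h p ih =>
      rintro ⟨n, hn⟩
      refine ih ⟨n + 1, ?_⟩
      simp only [S, Function.iterate_succ_apply']
      exact mem_biUnion.2 ⟨_, hn, (G.mem_neighborFinset _ _).2 h⟩
  have hcover : (Set.univ : Set V) ⊆ ⋃ n, (S n : Set V) := fun v _ => by
    obtain ⟨p⟩ := hG.preconnected v₀ v
    obtain ⟨n, hn⟩ := hS p ⟨0, by simp [S]⟩
    exact Set.mem_iUnion.2 ⟨n, hn⟩
  exact Set.countable_univ_iff.1
    ((Set.countable_iUnion fun n => (S n).countable_toSet).mono hcover)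

theorem not_adj_of_two_le_setDist {V : Type*} {G : SimpleGraph V} {U U' : Set V}
    (h : 2 ≤ setDist G U U') : ∀ i ∈ U, ∀ j ∈ U', i ≠ j ∧ ¬G.Adj i j := by
  intro i hi j hj
  have h2 : 2 ≤ G.edist i j := h.trans ((iInf₂_le i hi).trans (iInf₂_le j hj))
  constructor
  · rintro rfl
    simp at h2
  · intro hadj
    rw [SimpleGraph.edist_eq_one_iff_adj.2 hadj] at h2
    exact absurd h2 (by norm_num)

end

end BetaField

/-! ### The kernel and its 1-dependent mixture. -/

theorem mainTheorem12 {V : Type*} (G : SimpleGraph V) [G.LocallyFinite] (hG : G.Connected) :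
    ∃ ν : Kernel (G.edgeSet → ℝ) (V → ℝ),
      (∀ W : G.edgeSet → ℝ, (∀ e, 0 < W e) →
        BetaField.IsBetaLaw G W (ν W) ∧
          ∀ μ : Measure (V → ℝ), BetaField.IsBetaLaw G W μ → μ = ν W) ∧
      ∀ a : G.edgeSet → ℝ, (∀ e, 0 < a e) →
        IsProbabilityMeasure (BetaField.mixedLaw G a ν) ∧
          BetaField.OneDependent G (BetaField.mixedLaw G a ν) := by
  have := BetaField.countable_of_connected_of_locallyFinite hG
  refine ⟨(BetaField.cubeKernel G).map BetaField.negLog, fun W hW => ?_, fun a ha => ?_⟩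
  · rw [Kernel.map_apply _ BetaField.measurable_negLog]
    exact ⟨BetaField.isBetaLaw_map_negLog G hW (BetaField.integral_mom_cubeLaw G hW),
      fun μ hμ => hμ.eq_map_negLog (BetaField.integral_mom_cubeLaw G hW)⟩
  · have := BetaField.isProbabilityMeasure_gammaConductances G ha
    have hmix : BetaField.mixedLaw G a ((BetaField.cubeKernel G).map BetaField.negLog) =
        (BetaField.cubeKernel G ∘ₘ BetaField.gammaConductances G a).map BetaField.negLog :=
      (Measure.map_comp _ _ BetaField.measurable_negLog).symm
    rw [hmix]
    refine ⟨Measure.isProbabilityMeasure_map BetaField.measurable_negLog.aemeasurable,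
      fun U U' hUU' => ?_⟩
    have hind := BetaField.indepFun_restrict_cubeKernel_comp G ha
      (BetaField.not_adj_of_two_le_setDist hUU')
    -- `negLog` acts coordinatewise, so it commutes with restriction and preserves independence.
    have hind' := hind.comp (φ := BetaField.negLog) (ψ := BetaField.negLog)
      BetaField.measurable_negLog BetaField.measurable_negLog
    have hU : Measurable fun (β : V → ℝ) (i : U) => β i :=
      measurable_pi_lambda _ fun i => measurable_pi_apply _
    have hU' : Measurable fun (β : V → ℝ) (i : U') => β i :=
      measurable_pi_lambda _ fun i => measurable_pi_apply _
    have hlog := BetaField.measurable_negLog (V := V)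
    rw [indepFun_iff_map_prod_eq_prod_map_map hU.aemeasurable hU'.aemeasurable,
      Measure.map_map (hU.prodMk hU') hlog, Measure.map_map hU hlog, Measure.map_map hU' hlog]
    exact (indepFun_iff_map_prod_eq_prod_map_map (hU.comp hlog).aemeasurable
      (hU'.comp hlog).aemeasurable).1 hind'
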